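/- A restless multi-armed bandit (RMAB) consists of $M$ arms, of which $N$ are to be activated at each time, $1\le N<M$. Arm $i$ is a Markov decision process with finite state space $\mathcal S_i$, action set $\{0,1\}$ (action $1$ = activation), transition kernel $p_i(s'\mid s,a)$ and real-valued (hence bounded) reward function $r_i:\mathcal S_i\times\{0,1\}\to\mathbb R$. Every arm is unichain: under each deterministic stationary policy the induced Markov chain has exactly one recurrent class (plus possibly some transient states). For $\lambda\in\mathbb R$ let $$g_i(\lambda)=\sup_{\pi}\ \liminf_{T\to\infty}\frac1T\,\mathbb E_\pi\Big[\sum_{t=1}^T\big(r_i(s_i^t,a_i^t)-\lambda a_i^t\big)\Big]$$ be the optimal long-run average reward of the single-arm problem with activation cost $\lambda$ started in a given state $s_i^1$, the supremum being over all history-dependent randomized policies, and let $$f(\lambda)=\sum_{i=1}^M g_i(\lambda)+N\lambda .$$ Then, for every choice of the initial states $s_i^1\in\mathcal S_i$: (0) $g_i(\lambda)$ is a maximum and does not depend on the initial state: for all $i$ and $\lambda$ there is a policy $\pi$ for which, from every initial state, the limit $\lim_{T\to\infty}\frac1T\mathbb E_\pi[\sum_{t=1}^T(r_i(s_i^t,a_i^t)-\lambda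 a_i^t)]$ exists and equals $g_i(\lambda)$; (1) $f$ is piecewise linear on $\mathbb R$ (continuous, with finitely many breakpoints, and affine on every interval free of breakpoints); (2) $f$ is convex; (3) there is a (finite) $\lambda^*\in\mathbb R$ with $f(\lambda^*)=\min_{\lambda\in\mathbb R}f(\lambda)$. -/

import Mathlib

open Filter Topology

noncomputable section

namespace RMAB

/-- An arm with finite state space `S`: a Markov decision process with action set `{0, 1}`,
reward function `r` and transition kernel `p`, where `p s a s'` is the probability of moving
to `s'` when action `a` is taken in state `s`. -/
structure Arm (S : Type*) [Fintype S] where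
  r : S → Fin 2 → ℝ
  p : S → Fin 2 → S → ℝ
  p_nonneg : ∀ s a s', 0 ≤ p s a s'
  p_sum : ∀ s a, ∑ s', p s a s' = 1

/-- A (history-dependent, randomized) policy: `prob t h s a` is the probability of taking action
`a` when the current state is `s` and `h` lists the `t` earlier state-action pairs. -/
structure Policy (S : Type*) where
  prob : (t : ℕ) → (Fin t → S × Fin 2) → S → Fin 2 → ℝ
  prob_nonneg : ∀ t h s a, 0 ≤ prob t h s a
  prob_sum : ∀ t h s, ∑ a, prob t h s a = 1

namespace Arm

variable {S : Type*} [Fintype S]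

/-- One-step transitions of positive probability under the deterministic stationary policy `d`. -/
def Step (B : Arm S) (d : S → Fin 2) (s s' : S) : Prop :=
  0 < B.p s (d s) s'

/-- `s'` is accessible from `s` (in zero or more steps) under `d`. -/
def Accessible (B : Arm S) (d : S → Fin 2) : S → S → Prop :=
  Relation.ReflTransGen (B.Step d)

/-- `s` is a recurrent state of the finite Markov chain induced by `d`. -/
def Recurrent (B : Arm S) (d : S → Fin 2) (s : S) : Prop :=
  ∀ s', B.Accessible d s s' → B.Accessible d s' s

/-- The arm is unichain: under every deterministic stationary policy the induced Markov chain has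
a single recurrent class (and possibly some transient states). -/
def IsUnichain (B : Arm S) : Prop :=
  ∀ d : S → Fin 2, ∀ s s' : S, B.Recurrent d s → B.Recurrent d s' → B.Accessible d s s'

open Classical in
/-- Conditional probability that the current state is `s`, given the initial state `s₁` and the
`t` earlier state-action pairs `h`. -/
def stateProb (B : Arm S) (s₁ : S) : (t : ℕ) → (Fin t → S × Fin 2) → S → ℝ
  | 0, _, s => if s = s₁ then 1 else 0
  | t + 1, h, s => B.p (h (Fin.last t)).1 (h (Fin.last t)).2 s

/-- Probability of the first `T` state-action pairs being `ω` under the policy `π`, started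
in `s₁`. -/
def pathProb (B : Arm S) (π : Policy S) (s₁ : S) : (T : ℕ) → (Fin T → S × Fin 2) → ℝ
  | 0, _ => 1
  | T + 1, ω =>
      B.pathProb π s₁ T (Fin.init ω) *
        (B.stateProb s₁ T (Fin.init ω) (ω (Fin.last T)).1 *
          π.prob T (Fin.init ω) (ω (Fin.last T)).1 (ω (Fin.last T)).2)

/-- The `T`-step average `(1/T) E[∑ (r(sᵗ, aᵗ) - lam * aᵗ)]` under `π`, started in `s₁`. -/
def avgReward (B : Arm S) (lam : ℝ) (π : Policy S) (s₁ : S) (T : ℕ) : ℝ :=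
  (1 / (T : ℝ)) * ∑ ω : Fin T → S × Fin 2, B.pathProb π s₁ T ω *
    ∑ t : Fin T, (B.r (ω t).1 (ω t).2 - lam * (((ω t).2 : ℕ) : ℝ))

/-- The optimal long-run average reward of the single-arm problem with activation cost `lam`,
started in `s₁`. -/
def gain (B : Arm S) (s₁ : S) (lam : ℝ) : ℝ :=
  ⨆ π : Policy S, liminf (fun T : ℕ => B.avgReward lam π s₁ T) atTop

end Arm

/-- The Lagrangian dual function `f(lam) = ∑ i, g i lam + N * lam`. -/
def dual {M : ℕ} {S : Fin M → Type*} [∀ i, Fintype (S i)] (B : ∀ i, Arm (S i)) (N : ℕ)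
    (s₁ : ∀ i, S i) (lam : ℝ) : ℝ :=
  ∑ i, (B i).gain (s₁ i) lam + (N : ℝ) * lam

/-- `f` is piecewise linear: it is continuous and there are finitely many breakpoints such that
`f` is affine on every interval that contains none of them. -/
def IsPiecewiseLinear (f : ℝ → ℝ) : Prop :=
  Continuous f ∧ ∃ P : Finset ℝ, ∀ I : Set ℝ, I.OrdConnected → Disjoint I (P : Set ℝ) →
    ∃ m c : ℝ, ∀ x ∈ I, f x = m * x + c

end RMAB

end

/-! For a unichain arm the average-reward optimality equation `c s a + E h ≤ g + h s`, with equality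
along some stationary policy, is solvable (`IsUnichain.exists_optimality`). Telescoping it along any
policy bounds the `T`-step reward by `T * g + K`, and the stationary policy attains the rate `g`
from every state. So the gain is the maximum, over the finitely many stationary policies `d`, of `a
d - lam * b d`, where `b d` is the long-run activation rate (`IsUnichain.exists_gain_affine`). Hence
the dual is a maximum of finitely many affine functions, which makes it convex and piecewise linear.
Never activating gives slope `N > 0`, always activating gives slope `N - M < 0`, so it is coercive
and has a minimum. -/

namespace RMAB

namespace Arm

variable {S : Type*} [Fintype S]

/-! ### Closed sets and recurrence. -/

lemma Accessible.mem_of_closed {B : Arm S} {d : S → Fin 2} {E : Set S}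
    (hE : ∀ s ∈ E, ∀ s', B.Step d s s' → s' ∈ E) {s s' : S} (h : B.Accessible d s s')
    (hs : s ∈ E) : s' ∈ E := by
  induction h with
  | refl => exact hs
  | tail _ hstep ih => exact hE _ ih _ hstep

/-- Among the states accessible from `s`, one whose own accessible set is smallest is recurrent:
moving on from it cannot shrink that set. -/
lemma exists_recurrent_accessible (B : Arm S) (d : S → Fin 2) (s : S) :
    ∃ s', B.Accessible d s s' ∧ B.Recurrent d s' := by
  obtain ⟨s', hs', hmin⟩ := Set.exists_min_image {t | B.Accessible d s t}
    (fun t => {u | B.Accessible d t u}.ncard) (Set.toFinite _) ⟨s, Relation.ReflTransGen.refl⟩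
  refine ⟨s', hs', fun t ht => ?_⟩
  have hsub : {u | B.Accessible d t u} ⊆ {u | B.Accessible d s' u} :=
    fun u hu => Relation.ReflTransGen.trans ht hu
  have heq := Set.eq_of_subset_of_ncard_le hsub
    (hmin t (Relation.ReflTransGen.trans hs' ht)) (Set.toFinite _)
  have : s' ∈ {u | B.Accessible d s' u} := Relation.ReflTransGen.refl
  rw [← heq] at this
  exact this

/-- In a unichain arm, two nonempty sets closed under the same stationary policy meet. -/
lemma IsUnichain.inter_nonempty {B : Arm S} (hB : B.IsUnichain) (d : S → Fin 2) {E F : Set S}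
    (hE : ∀ s ∈ E, ∀ s', B.Step d s s' → s' ∈ E) (hF : ∀ s ∈ F, ∀ s', B.Step d s s' → s' ∈ F)
    (hE0 : E.Nonempty) (hF0 : F.Nonempty) : (E ∩ F).Nonempty := by
  obtain ⟨x, hx⟩ := hE0
  obtain ⟨y, hy⟩ := hF0
  obtain ⟨x', hx', rx⟩ := B.exists_recurrent_accessible d x
  obtain ⟨y', hy', ry⟩ := B.exists_recurrent_accessible d y
  exact ⟨y', (hB d x' y' rx ry).mem_of_closed hE (hx'.mem_of_closed hE hx),
    hy'.mem_of_closed hF hy⟩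

/-! ### One-step expectations and the maximum principle. -/

/-- Expectation of `h` after one step from `s` under action `a`. -/
def next (B : Arm S) (h : S → ℝ) (s : S) (a : Fin 2) : ℝ :=
  ∑ s', B.p s a s' * h s'

lemma next_sub (B : Arm S) (h k : S → ℝ) (s : S) (a : Fin 2) :
    B.next (fun x => h x - k x) s a = B.next h s a - B.next k s a := by
  simp [next, mul_sub, Finset.sum_sub_distrib]

lemma next_const (B : Arm S) (c : ℝ) (s : S) (a : Fin 2) : B.next (fun _ => c) s a = c := by
  simp [next, ← Finset.sum_mul, B.p_sum]

lemma next_neg (B : Arm S) (h : S → ℝ) (s : S) (a : Fin 2) :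
    B.next (fun x => -h x) s a = -B.next h s a := by
  simp [next]

lemma next_mono (B : Arm S) {h k : S → ℝ} (hk : ∀ x, h x ≤ k x) (s : S) (a : Fin 2) :
    B.next h s a ≤ B.next k s a :=
  Finset.sum_le_sum fun x _ => mul_le_mul_of_nonneg_left (hk x) (B.p_nonneg s a x)

/-- An average of values that are all at least `m` can be at most `m` only if every value of
positive weight equals `m`. -/
lemma eq_of_next_le (B : Arm S) {Δ : S → ℝ} {m : ℝ} (hm : ∀ x, m ≤ Δ x) {s : S} {a : Fin 2}
    (h : B.next Δ s a ≤ m) {s' : S} (hs' : 0 < B.p s a s') : Δ s' = m := by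
  have h0 : B.next (fun x => Δ x - m) s a ≤ 0 := by
    rw [next_sub, next_const]; linarith
  have hnn : ∀ x ∈ Finset.univ, 0 ≤ B.p s a x * (Δ x - m) :=
    fun x _ => mul_nonneg (B.p_nonneg s a x) (by linarith [hm x])
  have h1 := (Finset.sum_eq_zero_iff_of_nonneg hnn).1
    (le_antisymm h0 (Finset.sum_nonneg hnn)) s' (Finset.mem_univ _)
  rcases mul_eq_zero.1 h1 with h2 | h2 <;> linarith

lemma eq_of_le_next (B : Arm S) {Δ : S → ℝ} {m : ℝ} (hm : ∀ x, Δ x ≤ m) {s : S} {a : Fin 2}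
    (h : m ≤ B.next Δ s a) {s' : S} (hs' : 0 < B.p s a s') : Δ s' = m := by
  have := B.eq_of_next_le (Δ := fun x => -Δ x) (m := -m) (fun x => neg_le_neg (hm x))
    (by rw [next_neg]; linarith) hs'
  linarith

lemma nonneg_of_next_le [Nonempty S] (B : Arm S) {Δ : S → ℝ} {k : ℝ} (e : S → Fin 2)
    (h : ∀ s, B.next Δ s (e s) ≤ Δ s + k) : 0 ≤ k := by
  obtain ⟨s, hs⟩ := Finite.exists_min Δ
  have := B.next_mono hs s (e s)
  rw [next_const] at this
  linarith [h s]

lemma nonneg_of_le_next [Nonempty S] (B : Arm S) {Δ : S → ℝ} {k : ℝ} (e : S → Fin 2)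
    (h : ∀ s, Δ s ≤ B.next Δ s (e s) + k) : 0 ≤ k :=
  B.nonneg_of_next_le (Δ := fun x => -Δ x) e fun s => by rw [next_neg]; linarith [h s]

/-- In a unichain arm, a function that is superharmonic under one stationary policy and
subharmonic under another one is constant. -/
lemma IsUnichain.eq_of_super_of_sub {B : Arm S} (hB : B.IsUnichain) {Δ : S → ℝ} {e e' : S → Fin 2}
    (h : ∀ s, B.next Δ s (e s) ≤ Δ s) (h' : ∀ s, Δ s ≤ B.next Δ s (e' s)) (x y : S) :
    Δ x = Δ y := by
  classical
  have : Nonempty S := ⟨x⟩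
  obtain ⟨u, hu⟩ := Finite.exists_min Δ
  obtain ⟨v, hv⟩ := Finite.exists_max Δ
  suffices huv : Δ u = Δ v by linarith [hu x, hu y, hv x, hv y]
  by_contra hne
  -- Using `e` on the minimum set and `e'` elsewhere makes both the minimum set and the maximum set
  -- closed under one policy, so they must meet.
  obtain ⟨w, hw, hw'⟩ := hB.inter_nonempty (fun s => if Δ s = Δ u then e s else e' s)
    (E := {s | Δ s = Δ u}) (F := {s | Δ s = Δ v})
    (fun s hs s' hst => by
      simp only [Set.mem_ofPred_eq] at hs
      simp only [Step, hs, if_true] at hst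
      exact B.eq_of_next_le hu (by linarith [h s]) hst)
    (fun s hs s' hst => by
      simp only [Set.mem_ofPred_eq] at hs
      have : Δ s ≠ Δ u := by rw [hs]; exact Ne.symm hne
      simp only [Step, this, if_false] at hst
      exact B.eq_of_le_next hv (by linarith [h' s]) hst)
    ⟨u, rfl⟩ ⟨v, rfl⟩
  exact hne (hw.symm.trans hw')

/-! ### Poisson and optimality equations. -/

/-- The Poisson equation of a stationary policy in a unichain arm is solvable. -/
lemma IsUnichain.exists_poisson {B : Arm S} (hB : B.IsUnichain) [Nonempty S] (c : S → Fin 2 → ℝ)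
    (d : S → Fin 2) : ∃ (g : ℝ) (h : S → ℝ), ∀ s, c s (d s) + B.next h s (d s) = g + h s := by
  obtain ⟨s₀⟩ := ‹Nonempty S›
  have : Nonempty S := ⟨s₀⟩
  -- The term `h s₀` stands for the unknown gain; this normalization removes the constants from the
  -- kernel and makes the system square.
  let L : (S → ℝ) →ₗ[ℝ] (S → ℝ) :=
    { toFun := fun h s => h s - B.next h s (d s) + h s₀
      map_add' := fun h k => by
        ext s; simp [next, mul_add, Finset.sum_add_distrib]; ring
      map_smul' := fun a h => by
        ext s
        have : ∑ x, B.p s (d s) x * (a * h x) = a * ∑ x, B.p s (d s) x * h x := by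
          rw [Finset.mul_sum]; exact Finset.sum_congr rfl fun _ _ => by ring
        simp [next, this]; ring }
  have hinj : Function.Injective L := by
    rw [injective_iff_map_eq_zero]
    intro h hh
    have hh' : ∀ s, h s - B.next h s (d s) + h s₀ = 0 := fun s => congrFun hh s
    have h1 : 0 ≤ h s₀ := B.nonneg_of_next_le (Δ := h) d fun s => by linarith [hh' s]
    have h2 : 0 ≤ -h s₀ := B.nonneg_of_le_next (Δ := h) d fun s => by linarith [hh' s]
    have h3 : h s₀ = 0 := by linarith
    ext s
    rw [hB.eq_of_super_of_sub (Δ := h) (e := d) (e' := d) (fun s => by linarith [hh' s])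
      (fun s => by linarith [hh' s]) s s₀, h3]
    rfl
  obtain ⟨h, hh⟩ := LinearMap.surjective_of_injective hinj (fun s => c s (d s))
  refine ⟨h s₀, h, fun s => ?_⟩
  have : h s - B.next h s (d s) + h s₀ = c s (d s) := congrFun hh s
  linarith

/-- The average-reward optimality equation when both actions are allowed in the states of `U`, and
only the action prescribed by `d` outside of `U`; `e` is an optimal stationary policy. -/
lemma IsUnichain.exists_optimality_on {B : Arm S} (hB : B.IsUnichain) [Nonempty S]
    (c : S → Fin 2 → ℝ) (U : Finset S) : ∀ d : S → Fin 2, ∃ (g : ℝ) (h : S → ℝ) (e : S → Fin 2),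
      (∀ s ∉ U, e s = d s) ∧ (∀ s, c s (e s) + B.next h s (e s) = g + h s) ∧
      ∀ s ∈ U, ∀ a, c s a + B.next h s a ≤ g + h s := by
  classical
  induction U using Finset.induction_on with
  | empty =>
    intro d
    obtain ⟨g, h, hh⟩ := hB.exists_poisson c d
    exact ⟨g, h, d, fun _ _ => rfl, hh, by simp⟩
  | insert s₀ U hs₀ ih =>
    intro d
    -- Solve with the action at `s₀` frozen to 0, then to 1; one of the two solutions also satisfies
    -- the inequality for the other action.
    obtain ⟨g₀, h₀, e₀, he₀, heq₀, hle₀⟩ := ih (Function.update d s₀ 0)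
    obtain ⟨g₁, h₁, e₁, he₁, heq₁, hle₁⟩ := ih (Function.update d s₀ 1)
    have e₀s : e₀ s₀ = 0 := by simpa using he₀ s₀ hs₀
    have e₁s : e₁ s₀ = 1 := by simpa using he₁ s₀ hs₀
    have off₀ : ∀ s ∉ insert s₀ U, e₀ s = d s := fun s hs => by
      rw [Finset.mem_insert, not_or] at hs
      rw [he₀ s hs.2, Function.update_of_ne hs.1]
    have off₁ : ∀ s ∉ insert s₀ U, e₁ s = d s := fun s hs => by
      rw [Finset.mem_insert, not_or] at hs
      rw [he₁ s hs.2, Function.update_of_ne hs.1]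
    by_cases hc₀ : c s₀ 1 + B.next h₀ s₀ 1 ≤ g₀ + h₀ s₀
    · refine ⟨g₀, h₀, e₀, off₀, heq₀, fun s hs a => ?_⟩
      rcases Finset.mem_insert.1 hs with rfl | hs
      · have := heq₀ s
        rw [e₀s] at this
        fin_cases a
        exacts [this.le, hc₀]
      · exact hle₀ s hs a
    by_cases hc₁ : c s₀ 0 + B.next h₁ s₀ 0 ≤ g₁ + h₁ s₀
    · refine ⟨g₁, h₁, e₁, off₁, heq₁, fun s hs a => ?_⟩
      rcases Finset.mem_insert.1 hs with rfl | hs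
      · have := heq₁ s
        rw [e₁s] at this
        fin_cases a
        exacts [hc₁, this.le]
      · exact hle₁ s hs a
    -- Otherwise each solution strictly improves by switching at `s₀`. Comparing them under the
    -- switched policies forces equal gains and a constant `h₁ - h₀`, against the strictness at
    -- `s₀`.
    exfalso
    push Not at hc₀ hc₁
    have hx₀ := heq₀ s₀
    have hx₁ := heq₁ s₀
    rw [e₀s] at hx₀
    rw [e₁s] at hx₁
    have le₁ : ∀ s, s ≠ s₀ → c s (e₀ s) + B.next h₁ s (e₀ s) ≤ g₁ + h₁ s := fun s hs => by
      by_cases hsU : s ∈ U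
      · exact hle₁ s hsU _
      · have hsU' : s ∉ insert s₀ U := by simp [hs, hsU]
        rw [off₀ s hsU', ← off₁ s hsU']
        exact (heq₁ s).le
    have le₀ : ∀ s, s ≠ s₀ → c s (e₁ s) + B.next h₀ s (e₁ s) ≤ g₀ + h₀ s := fun s hs => by
      by_cases hsU : s ∈ U
      · exact hle₀ s hsU _
      · have hsU' : s ∉ insert s₀ U := by simp [hs, hsU]
        rw [off₁ s hsU', ← off₀ s hsU']
        exact (heq₀ s).le
    set Δ : S → ℝ := fun x => h₁ x - h₀ x with hΔ
    have hsup : ∀ s, B.next Δ s (Function.update e₀ s₀ 1 s) ≤ Δ s + (g₁ - g₀) := fun s => by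
      rw [hΔ, next_sub]
      by_cases hs : s = s₀
      · subst hs; rw [Function.update_self]; linarith
      · rw [Function.update_of_ne hs]; linarith [le₁ s hs, heq₀ s]
    have hsub : ∀ s, Δ s ≤ B.next Δ s (Function.update e₁ s₀ 0 s) + (g₀ - g₁) := fun s => by
      rw [hΔ, next_sub]
      by_cases hs : s = s₀
      · subst hs; rw [Function.update_self]; linarith
      · rw [Function.update_of_ne hs]; linarith [le₀ s hs, heq₁ s]
    have hg₁ := B.nonneg_of_next_le _ hsup
    have hg₀ := B.nonneg_of_le_next _ hsub
    have hconst := hB.eq_of_super_of_sub (fun s => (hsup s).trans (by linarith))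
      (fun s => (hsub s).trans (by linarith))
    have hΔ' : Δ = fun _ => Δ s₀ := funext fun s => hconst s s₀
    have hfix : B.next Δ s₀ 1 = Δ s₀ := by rw [hΔ', next_const]
    rw [hΔ, next_sub] at hfix
    linarith

lemma IsUnichain.exists_optimality {B : Arm S} (hB : B.IsUnichain) [Nonempty S]
    (c : S → Fin 2 → ℝ) : ∃ (g : ℝ) (h : S → ℝ) (e : S → Fin 2),
      (∀ s, c s (e s) + B.next h s (e s) = g + h s) ∧
      ∀ s a, c s a + B.next h s a ≤ g + h s := by
  obtain ⟨g, h, e, -, h1, h2⟩ := hB.exists_optimality_on c Finset.univ fun _ => 0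
  exact ⟨g, h, e, h1, fun s => h2 s (Finset.mem_univ s)⟩

/-! ### Expectations over histories. -/

lemma stateProb_nonneg (B : Arm S) (s₁ : S) (t : ℕ) (ω : Fin t → S × Fin 2) (s : S) :
    0 ≤ B.stateProb s₁ t ω s := by
  cases t with
  | zero => rw [stateProb]; split_ifs <;> simp
  | succ t => exact B.p_nonneg _ _ _

lemma stateProb_sum (B : Arm S) (s₁ : S) (t : ℕ) (ω : Fin t → S × Fin 2) :
    ∑ s, B.stateProb s₁ t ω s = 1 := by
  classical
  cases t with
  | zero => simp [stateProb]
  | succ t => exact B.p_sum _ _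

lemma pathProb_nonneg (B : Arm S) (π : Policy S) (s₁ : S) (T : ℕ) (ω : Fin T → S × Fin 2) :
    0 ≤ B.pathProb π s₁ T ω := by
  induction T with
  | zero => exact zero_le_one
  | succ T ih =>
    exact mul_nonneg (ih _) (mul_nonneg (B.stateProb_nonneg _ _ _ _) (π.prob_nonneg _ _ _ _))

/-- Expectation of a function of the first `T` state-action pairs. -/
noncomputable def pathExp (B : Arm S) (π : Policy S) (s₁ : S) (T : ℕ) (F : (Fin T → S × Fin 2) → ℝ) : ℝ :=
  ∑ ω, B.pathProb π s₁ T ω * F ω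

/-- Expectation of a function of the state-action pair that follows the history `ω`. -/
noncomputable def pairExp (B : Arm S) (π : Policy S) (s₁ : S) {T : ℕ} (ω : Fin T → S × Fin 2)
    (F : S → Fin 2 → ℝ) : ℝ :=
  ∑ s, B.stateProb s₁ T ω s * ∑ a, π.prob T ω s a * F s a

lemma pathExp_succ (B : Arm S) (π : Policy S) (s₁ : S) (T : ℕ)
    (F : (Fin (T + 1) → S × Fin 2) → ℝ) :
    B.pathExp π s₁ (T + 1) F =
      B.pathExp π s₁ T fun ω =>
        B.pairExp π s₁ ω fun s a => F (Fin.snoc (α := fun _ => S × Fin 2) ω (s, a)) := by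
  unfold pathExp pairExp
  rw [← (Fin.snocEquiv fun _ => S × Fin 2).sum_comp, Fintype.sum_prod_type_right]
  refine Finset.sum_congr rfl fun ω _ => ?_
  rw [Fintype.sum_prod_type, Finset.mul_sum]
  refine Finset.sum_congr rfl fun s _ => ?_
  rw [Finset.mul_sum, Finset.mul_sum]
  refine Finset.sum_congr rfl fun a _ => ?_
  rw [show (Fin.snocEquiv fun _ => S × Fin 2) ((s, a), ω) =
    Fin.snoc (α := fun _ => S × Fin 2) ω (s, a) from rfl, pathProb, Fin.init_snoc, Fin.snoc_last]
  ring

lemma pairExp_mono (B : Arm S) (π : Policy S) (s₁ : S) {T : ℕ} (ω : Fin T → S × Fin 2)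
    {F G : S → Fin 2 → ℝ} (h : ∀ s a, F s a ≤ G s a) :
    B.pairExp π s₁ ω F ≤ B.pairExp π s₁ ω G := by
  unfold pairExp
  gcongr with s _ a _
  · exact B.stateProb_nonneg _ _ _ _
  · exact π.prob_nonneg _ _ _ _
  · exact h s a

lemma pathExp_mono (B : Arm S) (π : Policy S) (s₁ : S) {T : ℕ}
    {F G : (Fin T → S × Fin 2) → ℝ} (h : ∀ ω, F ω ≤ G ω) :
    B.pathExp π s₁ T F ≤ B.pathExp π s₁ T G := by
  unfold pathExp
  gcongr with ω _
  · exact B.pathProb_nonneg _ _ _ _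
  · exact h ω

lemma pairExp_state (B : Arm S) (π : Policy S) (s₁ : S) {T : ℕ} (ω : Fin T → S × Fin 2)
    (h : S → ℝ) : B.pairExp π s₁ ω (fun s _ => h s) = ∑ s, B.stateProb s₁ T ω s * h s := by
  simp [pairExp, ← Finset.sum_mul, π.prob_sum]

lemma pairExp_add (B : Arm S) (π : Policy S) (s₁ : S) {T : ℕ} (ω : Fin T → S × Fin 2)
    (F G : S → Fin 2 → ℝ) : B.pairExp π s₁ ω (fun s a => F s a + G s a) =
      B.pairExp π s₁ ω F + B.pairExp π s₁ ω G := by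
  simp only [pairExp, mul_add, Finset.sum_add_distrib]

lemma pairExp_const (B : Arm S) (π : Policy S) (s₁ : S) {T : ℕ} (ω : Fin T → S × Fin 2)
    (k : ℝ) : B.pairExp π s₁ ω (fun _ _ => k) = k := by
  rw [pairExp_state, ← Finset.sum_mul, stateProb_sum, one_mul]

lemma pathExp_add (B : Arm S) (π : Policy S) (s₁ : S) {T : ℕ} (F G : (Fin T → S × Fin 2) → ℝ) :
    B.pathExp π s₁ T (fun ω => F ω + G ω) = B.pathExp π s₁ T F + B.pathExp π s₁ T G := by
  simp only [pathExp, mul_add, Finset.sum_add_distrib]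

lemma pathExp_const (B : Arm S) (π : Policy S) (s₁ : S) (T : ℕ) (k : ℝ) :
    B.pathExp π s₁ T (fun _ => k) = k := by
  induction T with
  | zero => simp [pathExp, pathProb]
  | succ T ih => rw [pathExp_succ]; simp only [pairExp_const]; exact ih

/-! ### Total rewards by telescoping. -/

/-- Expected total reward over `T` steps for the one-step reward `c`. -/
noncomputable def totalReward (B : Arm S) (c : S → Fin 2 → ℝ) (π : Policy S) (s₁ : S) (T : ℕ) : ℝ :=
  B.pathExp π s₁ T fun ω => ∑ t, c (ω t).1 (ω t).2

/-- Expected total reward over `T` steps plus the terminal reward `h`. -/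
noncomputable def totalRewardWith (B : Arm S) (c : S → Fin 2 → ℝ) (h : S → ℝ) (π : Policy S) (s₁ : S)
    (T : ℕ) : ℝ :=
  B.pathExp π s₁ T fun ω => ∑ t, c (ω t).1 (ω t).2 + ∑ s, B.stateProb s₁ T ω s * h s

lemma totalRewardWith_zero (B : Arm S) (c : S → Fin 2 → ℝ) (h : S → ℝ) (π : Policy S) (s₁ : S) :
    B.totalRewardWith c h π s₁ 0 = h s₁ := by
  classical
  simp [totalRewardWith, pathExp, pathProb, stateProb]

lemma totalRewardWith_succ (B : Arm S) (c : S → Fin 2 → ℝ) (h : S → ℝ) (π : Policy S) (s₁ : S)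
    (T : ℕ) : B.totalRewardWith c h π s₁ (T + 1) = B.pathExp π s₁ T fun ω =>
      ∑ t, c (ω t).1 (ω t).2 + B.pairExp π s₁ ω fun s a => c s a + B.next h s a := by
  rw [totalRewardWith, pathExp_succ]
  congr 1
  ext ω
  rw [← B.pairExp_const π s₁ ω (∑ t, c (ω t).1 (ω t).2), ← pairExp_add]
  congr 1
  ext s a
  simp only [Fin.sum_univ_castSucc, Fin.snoc_castSucc, Fin.snoc_last, stateProb, next]
  ring

/-- Cast in the shape of `totalRewardWith_succ`, so that the optimality inequality compares the
integrands pointwise. -/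
lemma totalRewardWith_add (B : Arm S) (c : S → Fin 2 → ℝ) (h : S → ℝ) (π : Policy S) (s₁ : S)
    (T : ℕ) (g : ℝ) : B.totalRewardWith c h π s₁ T + g = B.pathExp π s₁ T fun ω =>
      ∑ t, c (ω t).1 (ω t).2 + B.pairExp π s₁ ω fun s _ => g + h s := by
  rw [totalRewardWith]
  nth_rw 1 [← B.pathExp_const π s₁ T g]
  rw [← pathExp_add]
  refine congrArg (B.pathExp π s₁ T) (funext fun ω => ?_)
  rw [pairExp_add, pairExp_const, pairExp_state]
  ring

lemma totalRewardWith_le (B : Arm S) {c : S → Fin 2 → ℝ} {h : S → ℝ} {g : ℝ}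
    (hg : ∀ s a, c s a + B.next h s a ≤ g + h s) (π : Policy S) (s₁ : S) (T : ℕ) :
    B.totalRewardWith c h π s₁ T ≤ h s₁ + T * g := by
  induction T with
  | zero => simp [totalRewardWith_zero]
  | succ T ih =>
    have : B.totalRewardWith c h π s₁ (T + 1) ≤ B.totalRewardWith c h π s₁ T + g := by
      rw [totalRewardWith_succ, totalRewardWith_add]
      exact B.pathExp_mono π s₁ fun ω => add_le_add_right (B.pairExp_mono π s₁ ω hg) _
    push_cast
    linarith

lemma abs_totalRewardWith_sub (B : Arm S) (c : S → Fin 2 → ℝ) {h : S → ℝ} {H : ℝ}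
    (hH : ∀ s, |h s| ≤ H) (π : Policy S) (s₁ : S) (T : ℕ) :
    |B.totalRewardWith c h π s₁ T - B.totalReward c π s₁ T| ≤ H := by
  rw [totalRewardWith, pathExp_add, totalReward, add_sub_cancel_left, abs_le]
  simp only [← B.pairExp_state π s₁]
  constructor
  · calc -H = B.pathExp π s₁ T fun ω => B.pairExp π s₁ ω fun _ _ => -H := by
          simp only [pairExp_const, pathExp_const]
      _ ≤ _ := B.pathExp_mono π s₁ fun ω => B.pairExp_mono π s₁ ω fun s _ => (abs_le.1 (hH s)).1
  · calc _ ≤ B.pathExp π s₁ T fun ω => B.pairExp π s₁ ω fun _ _ => H :=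
          B.pathExp_mono π s₁ fun ω => B.pairExp_mono π s₁ ω fun s _ => (abs_le.1 (hH s)).2
      _ = H := by simp only [pairExp_const, pathExp_const]

/-- The terminal reward changes the total by a bounded amount only, so `K` can be chosen uniformly
in `π` and `T`. -/
lemma exists_totalReward_le (B : Arm S) {c : S → Fin 2 → ℝ} {h : S → ℝ} {g : ℝ}
    (hg : ∀ s a, c s a + B.next h s a ≤ g + h s) (s₁ : S) :
    ∃ K, ∀ (π : Policy S) (T : ℕ), B.totalReward c π s₁ T ≤ T * g + K := by
  obtain ⟨H, hH⟩ := Set.finite_range (fun s => |h s|) |>.bddAbove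
  refine ⟨h s₁ + H, fun π T => ?_⟩
  have h1 := B.totalRewardWith_le hg π s₁ T
  have h2 := abs_le.1 (B.abs_totalRewardWith_sub c (fun s => hH ⟨s, rfl⟩) π s₁ T)
  linarith

/-- The deterministic stationary policy given by `d`. -/
def _root_.RMAB.Policy.stationary {S : Type*} (d : S → Fin 2) : Policy S where
  prob _ _ s a := if a = d s then 1 else 0
  prob_nonneg _ _ s a := by split_ifs <;> simp
  prob_sum _ _ s := by simp

lemma pairExp_stationary (B : Arm S) (d : S → Fin 2) (s₁ : S) {T : ℕ} (ω : Fin T → S × Fin 2)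
    (F : S → Fin 2 → ℝ) : B.pairExp (Policy.stationary d) s₁ ω F =
      ∑ s, B.stateProb s₁ T ω s * F s (d s) := by
  simp [pairExp, Policy.stationary]

lemma totalRewardWith_stationary (B : Arm S) {c : S → Fin 2 → ℝ} {h : S → ℝ} {g : ℝ}
    {d : S → Fin 2} (hg : ∀ s, c s (d s) + B.next h s (d s) = g + h s) (s₁ : S) (T : ℕ) :
    B.totalRewardWith c h (Policy.stationary d) s₁ T = h s₁ + T * g := by
  induction T with
  | zero => simp [totalRewardWith_zero]
  | succ T ih =>
    have : B.totalRewardWith c h (Policy.stationary d) s₁ (T + 1) =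
        B.totalRewardWith c h (Policy.stationary d) s₁ T + g := by
      rw [totalRewardWith_succ, totalRewardWith_add]
      simp only [pairExp_stationary, hg]
    rw [this, ih]
    push_cast
    ring

/-- Under a stationary policy the average reward converges to the gain of its Poisson equation. -/
lemma tendsto_totalReward_stationary (B : Arm S) {c : S → Fin 2 → ℝ} {h : S → ℝ} {g : ℝ}
    {d : S → Fin 2} (hg : ∀ s, c s (d s) + B.next h s (d s) = g + h s) (s₁ : S) :
    Tendsto (fun T : ℕ => 1 / (T : ℝ) * B.totalReward c (Policy.stationary d) s₁ T) atTop
      (𝓝 g) := by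
  obtain ⟨H, hH⟩ := Set.finite_range (fun s => |h s|) |>.bddAbove
  rw [tendsto_iff_dist_tendsto_zero]
  have hlim : Tendsto (fun T : ℕ => 1 / (T : ℝ) * (|h s₁| + H)) atTop (𝓝 0) := by
    simpa using (tendsto_one_div_atTop_nhds_zero_nat (𝕜 := ℝ)).mul_const (|h s₁| + H)
  refine squeeze_zero' (Eventually.of_forall fun _ => dist_nonneg) ?_ hlim
  filter_upwards [eventually_gt_atTop 0] with T hT
  have hT' : (0 : ℝ) < T := Nat.cast_pos.2 hT
  have h1 := B.totalRewardWith_stationary hg s₁ T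
  have h2 := B.abs_totalRewardWith_sub c (fun s => hH ⟨s, rfl⟩) (Policy.stationary d) s₁ T
  rw [h1] at h2
  have h3 : 1 / (T : ℝ) * B.totalReward c (Policy.stationary d) s₁ T - g =
      1 / (T : ℝ) * (B.totalReward c (Policy.stationary d) s₁ T - T * g) := by
    field_simp
  rw [Real.dist_eq, h3, abs_mul, abs_of_pos (by positivity)]
  refine mul_le_mul_of_nonneg_left ?_ (by positivity)
  rw [abs_le] at h2 ⊢
  constructor <;> linarith [abs_le.1 (le_refl |h s₁|)]

/-! ### The gain as a function of the activation cost. -/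

/-- One-step reward with activation cost `lam`. -/
def costReward (B : Arm S) (lam : ℝ) (s : S) (a : Fin 2) : ℝ :=
  B.r s a - lam * ((a : ℕ) : ℝ)

lemma avgReward_eq (B : Arm S) (lam : ℝ) (π : Policy S) (s₁ : S) (T : ℕ) :
    B.avgReward lam π s₁ T = 1 / (T : ℝ) * B.totalReward (B.costReward lam) π s₁ T := rfl

lemma totalReward_costReward (B : Arm S) (lam : ℝ) (π : Policy S) (s₁ : S) (T : ℕ) :
    B.totalReward (B.costReward lam) π s₁ T =
      B.totalReward B.r π s₁ T - lam * B.totalReward (fun _ a => ((a : ℕ) : ℝ)) π s₁ T := by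
  simp only [totalReward, pathExp, costReward, Finset.sum_sub_distrib, mul_sub, Finset.mul_sum]
  congr 1
  exact Finset.sum_congr rfl fun _ _ => Finset.sum_congr rfl fun _ _ => by ring

lemma totalReward_neg (B : Arm S) (c : S → Fin 2 → ℝ) (π : Policy S) (s₁ : S) (T : ℕ) :
    B.totalReward (fun s a => -c s a) π s₁ T = -B.totalReward c π s₁ T := by
  simp [totalReward, pathExp]

/-- If `g` solves the optimality inequality, it bounds the lower average reward of every policy. -/
lemma liminf_avgReward_le (B : Arm S) {lam : ℝ} {h : S → ℝ} {g : ℝ}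
    (hg : ∀ s a, B.costReward lam s a + B.next h s a ≤ g + h s) (π : Policy S) (s₁ : S) :
    liminf (fun T : ℕ => B.avgReward lam π s₁ T) atTop ≤ g := by
  obtain ⟨K, hK⟩ := B.exists_totalReward_le hg s₁
  obtain ⟨C, hC⟩ := Set.finite_range (fun x : S × Fin 2 => -B.costReward lam x.1 x.2) |>.bddAbove
  -- The same bound for the negated reward, with `h = 0`, keeps the averages bounded below, as
  -- comparing the `liminf`s requires.
  obtain ⟨K', hK'⟩ := B.exists_totalReward_le (c := fun s a => -B.costReward lam s a)
    (h := fun _ => 0) (g := C) (fun s a => by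
      rw [next_const]; simpa using hC ⟨(s, a), rfl⟩) s₁
  have hinv := tendsto_one_div_atTop_nhds_zero_nat (𝕜 := ℝ)
  have hup : Tendsto (fun T : ℕ => g + 1 / (T : ℝ) * K) atTop (𝓝 g) := by
    simpa using (hinv.mul_const K).const_add g
  have hlo : Tendsto (fun T : ℕ => -C - 1 / (T : ℝ) * K') atTop (𝓝 (-C)) := by
    simpa using (hinv.mul_const K').const_sub (-C)
  have hle : ∀ᶠ T : ℕ in atTop, B.avgReward lam π s₁ T ≤ g + 1 / (T : ℝ) * K := by
    filter_upwards [eventually_gt_atTop 0] with T hT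
    have hT' : (0 : ℝ) < T := Nat.cast_pos.2 hT
    rw [avgReward_eq]
    calc _ ≤ 1 / (T : ℝ) * (T * g + K) := mul_le_mul_of_nonneg_left (hK π T) (by positivity)
      _ = _ := by field_simp
  have hge : ∀ᶠ T : ℕ in atTop, -C - 1 / (T : ℝ) * K' ≤ B.avgReward lam π s₁ T := by
    filter_upwards [eventually_gt_atTop 0] with T hT
    have hT' : (0 : ℝ) < T := Nat.cast_pos.2 hT
    have := hK' π T
    rw [totalReward_neg] at this
    rw [avgReward_eq]
    calc _ = 1 / (T : ℝ) * (-(T * C) - K') := by field_simp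
      _ ≤ _ := mul_le_mul_of_nonneg_left (by linarith) (by positivity)
  rw [← hup.liminf_eq]
  exact liminf_le_liminf hle (hlo.isBoundedUnder_ge.mono_ge hge) hup.isCoboundedUnder_ge

/-- The gain is a common limit of the average rewards of an optimal stationary policy, and bounds
the limits of all policies. -/
lemma IsUnichain.gain_spec {B : Arm S} (hB : B.IsUnichain) (s₁ : S) (lam : ℝ) :
    (∃ d : S → Fin 2, ∀ s, Tendsto (fun T : ℕ => B.avgReward lam (Policy.stationary d) s T) atTop
      (𝓝 (B.gain s₁ lam))) ∧
    ∀ (π : Policy S) (x : ℝ), Tendsto (fun T : ℕ => B.avgReward lam π s₁ T) atTop (𝓝 x) →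
      x ≤ B.gain s₁ lam := by
  have : Nonempty S := ⟨s₁⟩
  obtain ⟨g, h, d, heq, hle⟩ := hB.exists_optimality (B.costReward lam)
  have hlim : ∀ s, Tendsto (fun T : ℕ => B.avgReward lam (Policy.stationary d) s T) atTop (𝓝 g) :=
    fun s => B.tendsto_totalReward_stationary heq s
  have hub := fun π : Policy S => B.liminf_avgReward_le hle π s₁
  have : Nonempty (Policy S) := ⟨Policy.stationary d⟩
  have hbdd : BddAbove (Set.range fun π : Policy S =>
      liminf (fun T : ℕ => B.avgReward lam π s₁ T) atTop) := by
    refine ⟨g, ?_⟩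
    rintro _ ⟨π, rfl⟩
    exact hub π
  have hge : ∀ (π : Policy S) (x : ℝ), Tendsto (fun T : ℕ => B.avgReward lam π s₁ T) atTop (𝓝 x) →
      x ≤ B.gain s₁ lam := fun π x hx => by
    rw [← hx.liminf_eq]
    exact le_ciSup hbdd π
  have hgain : B.gain s₁ lam = g := le_antisymm (ciSup_le hub) (hge _ _ (hlim s₁))
  refine ⟨⟨d, fun s => ?_⟩, hge⟩
  rw [hgain]
  exact hlim s

/-- The gain is a maximum of finitely many affine functions of the activation cost, indexed by
the stationary policies. -/
lemma IsUnichain.exists_gain_affine {B : Arm S} (hB : B.IsUnichain) (s₁ : S) :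
    ∃ a b : (S → Fin 2) → ℝ, (∀ d lam, a d - lam * b d ≤ B.gain s₁ lam) ∧
      (∀ lam, ∃ d, B.gain s₁ lam = a d - lam * b d) ∧ b (fun _ => 0) = 0 ∧ b (fun _ => 1) = 1 := by
  have : Nonempty S := ⟨s₁⟩
  choose a u hu using hB.exists_poisson B.r
  choose b v hv using hB.exists_poisson (fun _ a => ((a : ℕ) : ℝ))
  have ha := fun d => B.tendsto_totalReward_stationary (hu d) s₁
  have hb := fun d => B.tendsto_totalReward_stationary (c := fun _ a => ((a : ℕ) : ℝ)) (hv d) s₁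
  have hlim : ∀ d lam, Tendsto (fun T : ℕ => B.avgReward lam (Policy.stationary d) s₁ T) atTop
      (𝓝 (a d - lam * b d)) := fun d lam => by
    refine ((ha d).sub ((hb d).const_mul lam)).congr fun T => ?_
    rw [avgReward_eq, totalReward_costReward]
    ring
  -- For a constant action, `h = 0` solves the Poisson equation of the activation count; uniqueness
  -- of limits identifies the chosen gain.
  have hconst : ∀ x : Fin 2, b (fun _ => x) = ((x : ℕ) : ℝ) := fun x => by
    refine tendsto_nhds_unique (hb fun _ => x) ?_
    exact B.tendsto_totalReward_stationary (h := fun _ => 0)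
      (fun s => by rw [next_const]) s₁
  refine ⟨a, b, fun d lam => (hB.gain_spec s₁ lam).2 _ _ (hlim d lam), fun lam => ?_,
    by simpa using hconst 0, by simpa using hconst 1⟩
  obtain ⟨d, hd⟩ := (hB.gain_spec s₁ lam).1
  exact ⟨d, tendsto_nhds_unique (hd s₁) (hlim d lam)⟩

end Arm

/-! ### Maxima of finitely many affine functions. -/

lemma convexOn_of_max_affine {ι : Type*} {f : ℝ → ℝ} {m c : ι → ℝ}
    (hle : ∀ i x, m i * x + c i ≤ f x) (hex : ∀ x, ∃ i, f x = m i * x + c i) :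
    ConvexOn ℝ Set.univ f := by
  refine ⟨convex_univ, fun x _ y _ α β hα hβ hαβ => ?_⟩
  obtain ⟨i, hi⟩ := hex (α • x + β • y)
  rw [hi]
  have h1 := mul_le_mul_of_nonneg_left (hle i x) hα
  have h2 := mul_le_mul_of_nonneg_left (hle i y) hβ
  simp only [smul_eq_mul]
  have h3 : c i = α * c i + β * c i := by rw [← add_mul, hαβ, one_mul]
  linarith

lemma isPiecewiseLinear_of_max_affine {ι : Type*} [Finite ι] {f : ℝ → ℝ} {m c : ι → ℝ}
    (hle : ∀ i x, m i * x + c i ≤ f x) (hex : ∀ x, ∃ i, f x = m i * x + c i) :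
    IsPiecewiseLinear f := by
  refine ⟨?_, ?_⟩
  · rw [← continuousOn_univ]
    exact (convexOn_of_max_affine hle hex).continuousOn isOpen_univ
  -- Breakpoints are the crossings of pairs of lines: if line `i` is active at `x` and `j` beats it
  -- at `y`, they cross between `x` and `y`. Parallel pairs only add the harmless point 0.
  have hfin := Set.finite_range fun q : ι × ι => (c q.2 - c q.1) / (m q.1 - m q.2)
  refine ⟨hfin.toFinset, fun I hI hdisj => ?_⟩
  rcases I.eq_empty_or_nonempty with rfl | ⟨x, hx⟩
  · exact ⟨0, 0, by simp⟩
  obtain ⟨i, hi⟩ := hex x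
  refine ⟨m i, c i, fun y hy => ?_⟩
  obtain ⟨j, hj⟩ := hex y
  by_contra hne
  have hlt : m i * y + c i < f y := lt_of_le_of_ne (hle i y) (Ne.symm hne)
  have hxj := hle j x
  rw [hj] at hlt
  rw [hi] at hxj
  have hz : (c j - c i) / (m i - m j) ∈ I := by
    rcases lt_trichotomy (m i) (m j) with hm | hm | hm
    · refine hI.out hx hy ⟨?_, ?_⟩
      · rw [le_div_iff_of_neg (by linarith)]; linarith
      · rw [div_le_iff_of_neg (by linarith)]; linarith
    · rw [hm] at hlt hxj; linarith
    · refine hI.out hy hx ⟨?_, ?_⟩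
      · rw [le_div_iff₀ (by linarith)]; linarith
      · rw [div_le_iff₀ (by linarith)]; linarith
  exact Set.disjoint_left.1 hdisj hz (by simp)

lemma exists_isMin_of_affine_le {f : ℝ → ℝ} (hf : Continuous f) {m₀ m₁ c₀ c₁ : ℝ} (hm₀ : 0 < m₀)
    (hm₁ : m₁ < 0) (h₀ : ∀ x, m₀ * x + c₀ ≤ f x) (h₁ : ∀ x, m₁ * x + c₁ ≤ f x) :
    ∃ x, ∀ y, f x ≤ f y := by
  refine hf.exists_forall_le ?_
  rw [cocompact_eq_atBot_atTop, tendsto_sup]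
  exact ⟨tendsto_atTop_mono h₁
      (tendsto_atTop_add_const_right _ _ (tendsto_id.const_mul_atBot_of_neg hm₁)),
    tendsto_atTop_mono h₀
      (tendsto_atTop_add_const_right _ _ (tendsto_id.const_mul_atTop hm₀))⟩

end RMAB

theorem lemma1 {M N : ℕ} (hN : 1 ≤ N) (hNM : N < M) {S : Fin M → Type*} [∀ i, Fintype (S i)]
    (B : ∀ i, RMAB.Arm (S i)) (hB : ∀ i, (B i).IsUnichain) (s₁ : ∀ i, S i) :
    -- the values `g i lam` are maxima, attained as genuine limits for every initial state
    (∀ i, ∀ lam : ℝ, ∃ π : RMAB.Policy (S i), ∀ s : S i,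
      Tendsto (fun T : ℕ => (B i).avgReward lam π s T) atTop (𝓝 ((B i).gain (s₁ i) lam))) ∧
    RMAB.IsPiecewiseLinear (RMAB.dual B N s₁) ∧
    ConvexOn ℝ Set.univ (RMAB.dual B N s₁) ∧
    ∃ lamStar : ℝ, ∀ lam : ℝ, RMAB.dual B N s₁ lamStar ≤ RMAB.dual B N s₁ lam := by
  choose a b hle hex hb₀ hb₁ using fun i => (hB i).exists_gain_affine (s₁ i)
  -- The affine pieces are indexed by `φ`, a stationary policy for each arm.
  let m : (∀ i, S i → Fin 2) → ℝ := fun φ => (N : ℝ) - ∑ i, b i (φ i)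
  let c : (∀ i, S i → Fin 2) → ℝ := fun φ => ∑ i, a i (φ i)
  have haff : ∀ φ lam, m φ * lam + c φ = ∑ i, (a i (φ i) - lam * b i (φ i)) + N * lam :=
    fun φ lam => by
      simp only [m, c, Finset.sum_sub_distrib, ← Finset.mul_sum]
      ring
  have hle' : ∀ φ lam, m φ * lam + c φ ≤ RMAB.dual B N s₁ lam := fun φ lam => by
    rw [haff, RMAB.dual]
    gcongr with i _
    exact hle i (φ i) lam
  have hex' : ∀ lam, ∃ φ, RMAB.dual B N s₁ lam = m φ * lam + c φ := fun lam => by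
    choose φ hφ using fun i => hex i lam
    refine ⟨φ, ?_⟩
    rw [haff, RMAB.dual]
    simp only [hφ]
  have hpl := RMAB.isPiecewiseLinear_of_max_affine hle' hex'
  refine ⟨fun i lam => ?_, hpl, RMAB.convexOn_of_max_affine hle' hex', ?_⟩
  · obtain ⟨d, hd⟩ := ((hB i).gain_spec (s₁ i) lam).1
    exact ⟨_, hd⟩
  · refine RMAB.exists_isMin_of_affine_le hpl.1 ?_ ?_ (hle' fun _ _ => 0) (hle' fun _ _ => 1)
    · simp only [m, hb₀, Finset.sum_const_zero, sub_zero]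
      exact_mod_cast hN
    · simp only [m, hb₁, Finset.sum_const, Finset.card_univ, Fintype.card_fin, nsmul_eq_mul,
        mul_one, sub_neg]
      exact_mod_cast hNM
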